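/- Let $\mathbf{C}$ be the space of continuous functions $x:[0,1]\to\mathbb{R}$ with $x(0)=0$, with the supremum metric, and let $\mathfrak{C}$ be its Borel $\sigma$-field. Let $t_1,t_2,\ldots$ be a sequence in $[0,1]$ whose set of values is dense in $[0,1]$ (in particular, any enumeration of a countable dense subset $T$ of $[0,1]$). For $n\ge 1$ let $\pi_n:\mathbf{C}\to\mathbb{R}^n$, $\pi_n(x)=(x(t_1),\ldots,x(t_n))$, let $\nu_n$ be the $n$-variate normal distribution on $\mathbb{R}^n$ with mean zero and covariance matrix $(\min\{t_i,t_j\})_{1\le i,j\le n}$, and let $\alpha_n$ be the measure on the $\sigma$-field $\{\pi_n^{-1}(B): B\subset\mathbb{R}^n \text{ Borel}\}$ given by $\alpha_n(\pi_n^{-1}(B))=\nu_n(B\cap\pi_n(\mathbf{C}))$ (here $\pi_n(\mathbf{C})=\mathbb{R}^n$ if $t_1,\ldots,t_n$ are distinct and positive). Then for every compact $K\subset\mathbf{C}$ the limit $$\varphi(K)=\lim_{n\to\infty}\alpha_n\big(\pi_n^{-1}\pi_n(K)\big)$$ exists, and the set function $$\mu(A)=\sup\{\varphi(K): K\subset A,\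 K \text{ compact}\},\qquad A\in\mathfrak{C},$$ is a probability measure on $\mathfrak{C}$: it is countably additive, i.e. $\mu\big(\bigcup_{n} A_n\big)=\sum_{n}\mu(A_n)$ for all pairwise disjoint $A_1,A_2,\ldots\in\mathfrak{C}$, and $\mu(\mathbf{C})=1$. -/

import Mathlib

open MeasureTheory ProbabilityTheory Filter Topology
open scoped ENNReal

/-- The space `C[0,1]` of real continuous functions on `[0,1]` that vanish at `0`, with the
supremum metric (inherited from `C([0,1], ℝ)`). -/
abbrev PathSpace : Type := {x : C(unitInterval, ℝ) // x 0 = 0}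

/-- The Borel `σ`-field of the path space. -/
instance PathSpace.instMeasurableSpace : MeasurableSpace PathSpace := borel PathSpace

instance PathSpace.instBorelSpace : BorelSpace PathSpace := ⟨rfl⟩

namespace PathSpace

/-- The projection `x ↦ (x(t 0), …, x(t (n-1)))` onto the first `n` of the times `t`. -/
def proj (t : ℕ → unitInterval) (n : ℕ) (x : PathSpace) : EuclideanSpace ℝ (Fin n) :=
  WithLp.toLp 2 fun i => x.1 (t i)

/-- The matrix `min (t i) (t j)`, for the first `n` of the times `t`. -/
def covMatrix (t : ℕ → unitInterval) (n : ℕ) : Matrix (Fin n) (Fin n) ℝ :=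
  .of fun i j => min (t i : ℝ) (t j : ℝ)

/-- The matrix `min (t i) (t j)` is a covariance matrix. -/
theorem posSemidef_covMatrix (t : ℕ → unitInterval) (n : ℕ) : (covMatrix t n).PosSemidef := by
  have h : covMatrix t n =
      .of fun i j : Fin n => volume.real (Set.Icc 0 (t i : ℝ) ∩ Set.Icc 0 (t j : ℝ)) := by
    ext i j
    have h0 : 0 ≤ min (t i : ℝ) (t j : ℝ) := le_min (t i).2.1 (t j).2.1
    simp [covMatrix, Set.Icc_inter_Icc, h0]
  rw [h]
  exact posSemidef_matrix_measure_inter (fun _ => measurableSet_Icc)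
    (fun _ => isCompact_Icc.measure_ne_top)

/-- The centred normal law on `ℝⁿ` with covariances `min (t i) (t j)`. -/
noncomputable def gaussianLaw (t : ℕ → unitInterval) (n : ℕ) :
    Measure (EuclideanSpace ℝ (Fin n)) :=
  multivariateGaussian 0 (covMatrix t n)

/-- The sub-`σ`-field of the cylinder sets `proj t n ⁻¹' B` with `B` a Borel subset of `ℝⁿ`. -/
abbrev cylinderField (t : ℕ → unitInterval) (n : ℕ) : MeasurableSpace PathSpace :=
  MeasurableSpace.comap (proj t n) inferInstance

theorem cylinderField_le_caratheodory (t : ℕ → unitInterval) (n : ℕ) :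
    cylinderField t n ≤
      (OuterMeasure.comap (proj t n) (gaussianLaw t n).toOuterMeasure).caratheodory := by
  rintro _ ⟨B, hB, rfl⟩ A
  simp only [OuterMeasure.comap_apply, Set.image_inter_preimage, Set.image_sdiff_preimage]
  exact (measure_inter_add_sdiff _ hB).symm

/-- The measure on the cylinder `σ`-field generated by the normal law through the projection. -/
noncomputable def cylinderMeasure (t : ℕ → unitInterval) (n : ℕ) :
    @Measure PathSpace (cylinderField t n) :=
  @OuterMeasure.toMeasure PathSpace (cylinderField t n)
    (OuterMeasure.comap (proj t n) (gaussianLaw t n).toOuterMeasure)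
    (cylinderField_le_caratheodory t n)

/-- The cylinder over a Borel set `B` has the normal mass of `B`, intersected with the range of
the projection (all of `ℝⁿ` when the times are distinct and positive). -/
theorem cylinderMeasure_preimage (t : ℕ → unitInterval) (n : ℕ)
    {B : Set (EuclideanSpace ℝ (Fin n))} (hB : MeasurableSet B) :
    cylinderMeasure t n (proj t n ⁻¹' B) = gaussianLaw t n (B ∩ Set.range (proj t n)) := by
  rw [cylinderMeasure, @toMeasure_apply _ (cylinderField t n) _ _ _ ⟨B, hB, rfl⟩,
    OuterMeasure.comap_apply, Set.image_preimage_eq_inter_range]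
  rfl

/-- The mass of the `n`-th cylinder set `proj t n ⁻¹' (proj t n '' K)` around `K`. -/
noncomputable def cylinderMass (t : ℕ → unitInterval) (K : Set PathSpace) (n : ℕ) : ℝ≥0∞ :=
  cylinderMeasure t n (proj t n ⁻¹' (proj t n '' K))

/-- `φ(K)`, the limit of the masses of the cylinder sets around the compact set `K`. -/
noncomputable def phi (t : ℕ → unitInterval) (K : Set PathSpace) : ℝ≥0∞ :=
  limUnder atTop (cylinderMass t K)

/-- `μ(A)`, the supremum of `φ(K)` over the compact sets `K ⊆ A`. -/
noncomputable def mu (t : ℕ → unitInterval) (A : Set PathSpace) : ℝ≥0∞ :=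
  ⨆ (K : Set PathSpace) (_ : IsCompact K) (_ : K ⊆ A), phi t K

end PathSpace

/-! The set function `mu` is Wiener measure `W` seen from inside. Given `W` on path space with the
normal laws as its projections (`exists_wienerMeasure`), the cylinder masses around a compact `K`
are the `W`-masses of a decreasing sequence of sets. By compactness and density of the times these
sets intersect in `K` (`iInter_preimage_proj_image`), so `phi` equals `W` on compact sets
(`phi_eq`). Inner regularity of finite Borel measures on path space then gives `mu = W` on Borel
sets (`mu_eq`).

`W` is the law of a random Schauder series. The covariance of the Brownian bridge is self-similar
under halving the interval (`bridgeCov_eq_add`); iteration expands it in products of tents, an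
elementary Parseval identity. The substitution `(1 + t) b (t / (1 + t))` turns the bridge into
Brownian motion. Tents of one level have disjoint supports, so fourth moments suffice for almost
sure uniform convergence (`ae_exists_tendsto_schauderSum`). Characteristic functions identify the
projections. -/

namespace PathSpace

/-! ### The Schauder system and the covariance of the Brownian bridge -/

/-- The tent on `[0, 1]` of height `1 / 2`, extended by zero. -/
noncomputable def tent (u : ℝ) : ℝ := max 0 (1 / 2 - |u - 1 / 2|)

theorem continuous_tent : Continuous tent := by
  unfold tent; fun_prop

theorem tent_nonneg (u : ℝ) : 0 ≤ tent u := le_max_left _ _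

theorem tent_le_half (u : ℝ) : tent u ≤ 1 / 2 :=
  max_le (by norm_num) (by linarith [abs_nonneg (u - 1 / 2)])

theorem tent_eq_zero {u : ℝ} (hu : ¬ (0 < u ∧ u < 1)) : tent u = 0 := by
  refine max_eq_left ?_
  rcases abs_cases (u - 1 / 2) with h | h
  · by_contra h'
    exact hu ⟨by linarith, by linarith⟩
  · by_contra h'
    exact hu ⟨by linarith, by linarith⟩

/-- The projection of the real line onto the unit interval. -/
noncomputable def clamp (s : ℝ) : ℝ := max 0 (min s 1)

/-- The covariance of the Brownian bridge on `[0, 1]`, extended by zero. -/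
noncomputable def bridgeCov (s t : ℝ) : ℝ :=
  min (clamp s) (clamp t) - clamp s * clamp t

theorem clamp_of_nonpos {s : ℝ} (h : s ≤ 0) : clamp s = 0 := by
  rw [clamp, max_eq_left ((min_le_left _ _).trans h)]

theorem clamp_of_one_le {s : ℝ} (h : 1 ≤ s) : clamp s = 1 := by
  rw [clamp, min_eq_right h, max_eq_right zero_le_one]

theorem clamp_of_mem {s : ℝ} (h : 0 ≤ s) (h' : s ≤ 1) : clamp s = s := by
  rw [clamp, min_eq_left h', max_eq_right h]

theorem clamp_nonneg (s : ℝ) : 0 ≤ clamp s := le_max_left _ _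

theorem clamp_le_one (s : ℝ) : clamp s ≤ 1 := max_le zero_le_one (min_le_right _ _)

theorem bridgeCov_comm (s t : ℝ) : bridgeCov s t = bridgeCov t s := by
  rw [bridgeCov, bridgeCov, min_comm, mul_comm]

theorem bridgeCov_eq_zero {s : ℝ} (hs : ¬ (0 < s ∧ s < 1)) (t : ℝ) : bridgeCov s t = 0 := by
  rcases le_or_gt s 0 with h | h
  · rw [bridgeCov, clamp_of_nonpos h, min_eq_left (clamp_nonneg t)]; ring
  · rw [bridgeCov, clamp_of_one_le (not_lt.1 fun h' => hs ⟨h, h'⟩),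
      min_eq_right (clamp_le_one t)]; ring

theorem abs_bridgeCov_le_one (s t : ℝ) : |bridgeCov s t| ≤ 1 := by
  have h1 := clamp_nonneg s
  have h2 := clamp_le_one s
  have h3 := clamp_nonneg t
  have h4 := clamp_le_one t
  have h5 : 0 ≤ min (clamp s) (clamp t) := le_min h1 h3
  have h6 : min (clamp s) (clamp t) ≤ 1 := (min_le_left _ _).trans h2
  have h7 : clamp s * clamp t ≤ 1 := mul_le_one₀ h2 h3 h4
  have h8 : 0 ≤ clamp s * clamp t := mul_nonneg h1 h3
  rw [bridgeCov, abs_le]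
  constructor <;> linarith

/-- The self-similarity of the covariance of the Brownian bridge. -/
theorem bridgeCov_eq_add (s t : ℝ) : bridgeCov s t = tent s * tent t +
    (bridgeCov (2 * s) (2 * t) + bridgeCov (2 * s - 1) (2 * t - 1)) / 2 := by
  wlog hst : s ≤ t generalizing s t
  · rw [bridgeCov_comm, this t s (le_of_not_ge hst), bridgeCov_comm (2 * s),
      bridgeCov_comm (2 * s - 1), mul_comm (tent s)]
  by_cases hs : s ≤ 0
  · rw [bridgeCov_eq_zero (by intro h; linarith), bridgeCov_eq_zero (by intro h; linarith),
      bridgeCov_eq_zero (by intro h; linarith), tent_eq_zero (by intro h; linarith)]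
    ring
  by_cases ht : 1 ≤ t
  · rw [bridgeCov_comm, bridgeCov_comm (2 * s), bridgeCov_comm (2 * s - 1),
      bridgeCov_eq_zero (by intro h; linarith), bridgeCov_eq_zero (by intro h; linarith),
      bridgeCov_eq_zero (by intro h; linarith), tent_eq_zero (u := t) (by intro h; linarith)]
    ring
  push Not at hs ht
  have h0 : bridgeCov s t = s - s * t := by
    rw [bridgeCov, clamp_of_mem hs.le (by linarith), clamp_of_mem (by linarith) ht.le,
      min_eq_left hst]
  have tent_left : ∀ u : ℝ, 0 < u → u ≤ 1 / 2 → tent u = u := fun u h h' => by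
    rw [tent, abs_of_nonpos (by linarith), max_eq_right (by linarith)]; ring
  have tent_right : ∀ u : ℝ, 1 / 2 ≤ u → u < 1 → tent u = 1 - u := fun u h h' => by
    rw [tent, abs_of_nonneg (by linarith), max_eq_right (by linarith)]; ring
  -- For points in the same half, one rescaled covariance vanishes; for points in different halves
  -- both do, and the tent product is already the whole covariance.
  rcases le_total s (1 / 2) with h1 | h1 <;> rcases le_total t (1 / 2) with h2 | h2
  · rw [h0, tent_left s hs h1, tent_left t (by linarith) h2,
      bridgeCov_eq_zero (s := 2 * s - 1) (by intro h; linarith), bridgeCov,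
      clamp_of_mem (by linarith) (by linarith), clamp_of_mem (by linarith) (by linarith),
      min_eq_left (by linarith)]
    ring
  · rw [h0, tent_left s hs h1, tent_right t h2 ht,
      bridgeCov_eq_zero (s := 2 * s - 1) (by intro h; linarith), bridgeCov_comm,
      bridgeCov_eq_zero (s := 2 * t) (by intro h; linarith)]
    ring
  · obtain rfl : s = 1 / 2 := by linarith
    obtain rfl : t = 1 / 2 := by linarith
    rw [h0, tent_left _ hs h1, bridgeCov_eq_zero (by intro h; linarith),
      bridgeCov_eq_zero (by intro h; linarith)]
    ring
  · rw [h0, tent_right s h1 (by linarith), tent_right t h2 ht,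
      bridgeCov_eq_zero (s := 2 * s) (by intro h; linarith), bridgeCov,
      clamp_of_mem (by linarith) (by linarith), clamp_of_mem (by linarith) (by linarith),
      min_eq_left (by linarith)]
    ring

theorem sum_range_two_mul (f : ℕ → ℝ) (N : ℕ) :
    ∑ k ∈ Finset.range (2 * N), f k = ∑ k ∈ Finset.range N, (f (2 * k) + f (2 * k + 1)) := by
  induction N with
  | zero => simp
  | succ N ih => rw [mul_add, mul_one, Finset.sum_range_succ, Finset.sum_range_succ, ih,
      Finset.sum_range_succ]; ring

/-- Iterated self-similarity: the dyadic interval `k` of one level splits into the intervals `2 * k`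
and `2 * k + 1` of the next. -/
theorem bridgeCov_eq_sum (s t : ℝ) (n : ℕ) : bridgeCov s t =
    ∑ m ∈ Finset.range n, (1 / 2) ^ m *
      ∑ k ∈ Finset.range (2 ^ m), tent (2 ^ m * s - k) * tent (2 ^ m * t - k) +
    (1 / 2) ^ n * ∑ k ∈ Finset.range (2 ^ n), bridgeCov (2 ^ n * s - k) (2 ^ n * t - k) := by
  induction n with
  | zero => simp
  | succ n ih =>
    rw [ih, Finset.sum_range_succ, add_assoc]
    congr 1
    rw [pow_succ' (2 : ℕ) n, sum_range_two_mul, pow_succ (1 / 2 : ℝ) n, mul_assoc, ← mul_add,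
      Finset.mul_sum _ _ (1 / 2 : ℝ), ← Finset.sum_add_distrib]
    congr 1
    refine Finset.sum_congr rfl fun k _ => ?_
    rw [bridgeCov_eq_add]
    push_cast
    ring_nf

/-- At most one of the unit intervals `(k, k + 1)` contains a given point. -/
theorem abs_sum_le_of_support {f : ℝ → ℝ} {a : ℕ → ℝ} {C : ℝ} (hC : 0 ≤ C) (N : ℕ) (u : ℝ)
    (hf : ∀ x, ¬ (0 < x ∧ x < 1) → f x = 0) (ha : ∀ k < N, |a k * f (u - k)| ≤ C) :
    |∑ k ∈ Finset.range N, a k * f (u - k)| ≤ C := by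
  by_cases h : ∃ k ∈ Finset.range N, 0 < u - k ∧ u - k < 1
  · obtain ⟨k, hk, hk1, hk2⟩ := h
    rw [Finset.sum_eq_single_of_mem k hk]
    · exact ha k (Finset.mem_range.1 hk)
    · intro j _ hjk
      rw [hf, mul_zero]
      rintro ⟨hj1, hj2⟩
      apply hjk
      have h1 : (j : ℝ) < k + 1 := by linarith
      have h2 : (k : ℝ) < j + 1 := by linarith
      norm_cast at h1 h2
      omega
  · push Not at h
    rw [Finset.sum_eq_zero, abs_zero]
    · exact hC
    · intro k hk
      rw [hf, mul_zero]
      rintro ⟨h1, h2⟩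
      exact (h k hk h1).not_gt h2

theorem tendsto_sum_tent_mul_tent (s t : ℝ) :
    Tendsto (fun n => ∑ m ∈ Finset.range n, (1 / 2 : ℝ) ^ m *
      ∑ k ∈ Finset.range (2 ^ m), tent (2 ^ m * s - k) * tent (2 ^ m * t - k))
      atTop (𝓝 (bridgeCov s t)) := by
  rw [tendsto_iff_norm_sub_tendsto_zero]
  refine squeeze_zero (fun _ => norm_nonneg _) (fun n => ?_)
    (tendsto_pow_atTop_nhds_zero_of_lt_one (r := (1 / 2 : ℝ)) (by norm_num) (by norm_num))
  rw [bridgeCov_eq_sum s t n, sub_add_cancel_left, norm_neg, norm_mul, norm_pow, Real.norm_eq_abs,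
    Real.norm_eq_abs, abs_of_pos (by norm_num : (0 : ℝ) < 1 / 2)]
  refine mul_le_of_le_one_right (by positivity) ?_
  -- The remainder depends on `k` through both points, so the covariances serve as coefficients and
  -- the indicator of `(0, 1)` records the support in the first point.
  have := abs_sum_le_of_support (f := fun x => if 0 < x ∧ x < 1 then 1 else 0)
    (a := fun k : ℕ => bridgeCov (2 ^ n * s - k) (2 ^ n * t - k)) zero_le_one (2 ^ n) (2 ^ n * s)
    (fun x hx => if_neg hx) (fun k _ => ?_)
  · rwa [Finset.sum_congr rfl fun k _ => ?_] at this
    split_ifs with h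
    · rw [mul_one]
    · rw [mul_zero, bridgeCov_eq_zero h]
  · split_ifs with h
    · rw [mul_one]; exact abs_bridgeCov_le_one _ _
    · simp

/-- The time change which turns a Brownian bridge into a Brownian motion. -/
noncomputable def bridgeTime (s : ℝ) : ℝ := s / (1 + s)

/-- For `s ≤ t` the left side is `s * (1 + t) - s * t = s`. The time change stays in `[0, 1 / 2]`,
where `clamp` is the identity. -/
theorem mul_bridgeCov_bridgeTime (s t : unitInterval) :
    (1 + s) * (1 + t) * bridgeCov (bridgeTime s) (bridgeTime t) = min (s : ℝ) t := by
  wlog hst : s ≤ t generalizing s t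
  · rw [bridgeCov_comm, mul_comm (1 + (s : ℝ)), this t s (le_of_not_ge hst), min_comm]
  have hst' : (s : ℝ) ≤ t := hst
  have hs := s.2.1
  have ht := t.2.1
  have h : ∀ u : ℝ, 0 ≤ u → clamp (bridgeTime u) = u / (1 + u) := fun u hu =>
    clamp_of_mem (by unfold bridgeTime; positivity)
      (by unfold bridgeTime; rw [div_le_one (by linarith)]; linarith)
  rw [bridgeCov, h _ hs, h _ ht, min_eq_left hst', min_eq_left]
  · field_simp
    ring
  · rw [div_le_div_iff₀ (by linarith) (by linarith)]
    nlinarith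

/-- The Schauder functions of the Brownian motion `(1 + t) b (t / (1 + t))`, where `b` is a
Brownian bridge. -/
noncomputable def schauder (m k : ℕ) : PathSpace :=
  ⟨⟨fun t => (1 + t) * ((√2)⁻¹ ^ m * tent (2 ^ m * bridgeTime t - k)), by
    have : Continuous fun t : unitInterval => bridgeTime t :=
      continuous_subtype_val.div (by fun_prop) fun t => by linarith [t.2.1]
    have := continuous_tent
    fun_prop⟩, by
    have : tent (-(k : ℝ)) = 0 := tent_eq_zero fun h => by
      linarith [h.1, (Nat.cast_nonneg k : (0 : ℝ) ≤ k)]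
    simp [bridgeTime, this]⟩

theorem schauder_apply (m k : ℕ) (t : unitInterval) : (schauder m k).1 t =
    (1 + t) * ((√2)⁻¹ ^ m * tent (2 ^ m * bridgeTime t - k)) := rfl

/-- The Parseval identity for the Schauder functions. -/
theorem tendsto_sum_schauder_mul_schauder (s t : unitInterval) :
    Tendsto (fun n => ∑ m ∈ Finset.range n, ∑ k ∈ Finset.range (2 ^ m),
      (schauder m k).1 s * (schauder m k).1 t) atTop (𝓝 (min (s : ℝ) t)) := by
  rw [← mul_bridgeCov_bridgeTime]
  refine ((tendsto_sum_tent_mul_tent (bridgeTime s) (bridgeTime t)).const_mul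
    ((1 + (s : ℝ)) * (1 + t))).congr fun n => ?_
  rw [Finset.mul_sum]
  refine Finset.sum_congr rfl fun m _ => ?_
  rw [Finset.mul_sum, Finset.mul_sum]
  refine Finset.sum_congr rfl fun k _ => ?_
  have : (√2)⁻¹ ^ m * (√2)⁻¹ ^ m = (1 / 2 : ℝ) ^ m := by
    rw [← mul_pow, ← mul_inv, Real.mul_self_sqrt zero_le_two, one_div]
  rw [schauder_apply, schauder_apply, ← this]
  ring

theorem abs_sum_mul_schauder_le {z : ℕ → ℝ} {C : ℝ} (m : ℕ) (hz : ∀ k < 2 ^ m, |z k| ≤ C)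
    (t : unitInterval) :
    |∑ k ∈ Finset.range (2 ^ m), z k * (schauder m k).1 t| ≤ (√2)⁻¹ ^ m * C := by
  have hC : 0 ≤ C := (abs_nonneg _).trans (hz 0 (by positivity))
  have ht0 := t.2.1
  have ht1 := t.2.2
  have h := abs_sum_le_of_support (f := tent) (a := z) (C := C / 2) (by positivity) (2 ^ m)
    (2 ^ m * bridgeTime t) (fun x hx => tent_eq_zero hx) (fun k hk => by
      rw [abs_mul, abs_of_nonneg (tent_nonneg _), div_eq_mul_one_div]
      exact mul_le_mul (hz k hk) (tent_le_half _) (tent_nonneg _) hC)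
  have e : ∑ k ∈ Finset.range (2 ^ m), z k * (schauder m k).1 t = (1 + t) * ((√2)⁻¹ ^ m *
      ∑ k ∈ Finset.range (2 ^ m), z k * tent (2 ^ m * bridgeTime t - k)) := by
    rw [Finset.mul_sum, Finset.mul_sum]
    exact Finset.sum_congr rfl fun k _ => by rw [schauder_apply]; ring
  rw [e, abs_mul, abs_mul, abs_of_nonneg (by linarith : (0 : ℝ) ≤ 1 + t),
    abs_of_nonneg (by positivity : 0 ≤ (√2 : ℝ)⁻¹ ^ m)]
  -- The factor `1 + t ≤ 2` cancels the tent height `1 / 2`.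
  calc (1 + (t : ℝ)) * ((√2)⁻¹ ^ m * _) ≤ 2 * ((√2)⁻¹ ^ m * (C / 2)) := by gcongr; linarith
    _ = _ := by ring

/-! ### The Lévy–Ciesielski construction of the Wiener measure -/

theorem isClosed_setOf_apply_zero : IsClosed {x : C(unitInterval, ℝ) | x 0 = 0} :=
  isClosed_eq (ContinuousEvalConst.continuous_eval_const 0) continuous_const

instance instCompleteSpace : CompleteSpace PathSpace :=
  isClosed_setOf_apply_zero.completeSpace_coe

theorem continuous_proj (t : ℕ → unitInterval) (n : ℕ) : Continuous (proj t n) :=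
  (PiLp.continuous_toLp 2 _).comp (continuous_pi fun i =>
    (ContinuousEvalConst.continuous_eval_const (t i)).comp continuous_subtype_val)

/-- The law of a doubly indexed family of independent standard normal variables. -/
noncomputable def gaussianNoise : Measure ((Σ _ : ℕ, ℕ) → ℝ) :=
  Measure.infinitePi fun _ => gaussianReal 0 1

instance : IsProbabilityMeasure gaussianNoise := by
  unfold gaussianNoise; infer_instance

/-- The indices of the Schauder functions of the first `N` levels. -/
def levels (N : ℕ) : Finset (Σ _ : ℕ, ℕ) :=
  (Finset.range N).sigma fun m => Finset.range (2 ^ m)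

/-- The partial sums of the Schauder expansion of the Brownian motion. -/
noncomputable def schauderSum (N : ℕ) (ω : (Σ _ : ℕ, ℕ) → ℝ) : PathSpace :=
  ⟨∑ p ∈ levels N, ω p • (schauder p.1 p.2).1, by
    rw [ContinuousMap.sum_apply]
    exact Finset.sum_eq_zero fun p _ => by
      rw [ContinuousMap.smul_apply, (schauder p.1 p.2).2, smul_zero]⟩

theorem schauderSum_apply (N : ℕ) (ω : (Σ _ : ℕ, ℕ) → ℝ) (t : unitInterval) :
    (schauderSum N ω).1 t = ∑ p ∈ levels N, ω p * (schauder p.1 p.2).1 t := by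
  simp [schauderSum, ContinuousMap.sum_apply]

theorem continuous_schauderSum (N : ℕ) : Continuous (schauderSum N) := by
  unfold schauderSum
  fun_prop

theorem dist_schauderSum_succ_le {ω : (Σ _ : ℕ, ℕ) → ℝ} {N : ℕ} {C : ℝ}
    (h : ∀ k < 2 ^ N, |ω ⟨N, k⟩| ≤ C) :
    dist (schauderSum N ω) (schauderSum (N + 1) ω) ≤ (√2)⁻¹ ^ N * C := by
  have hC : 0 ≤ C := (abs_nonneg _).trans (h 0 (by positivity))
  rw [Subtype.dist_eq, ContinuousMap.dist_le (by positivity)]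
  intro t
  have : (schauderSum (N + 1) ω).1 t = (schauderSum N ω).1 t +
      ∑ k ∈ Finset.range (2 ^ N), ω ⟨N, k⟩ * (schauder N k).1 t := by
    rw [schauderSum_apply, schauderSum_apply, levels, levels, Finset.sum_sigma, Finset.sum_sigma,
      Finset.sum_range_succ]
  rw [Real.dist_eq, this, sub_add_cancel_left, abs_neg]
  exact abs_sum_mul_schauder_le N h t

/-- Bounds the largest coefficient of a level by a sum of fourth powers, which replaces Gaussian
tail estimates. -/
theorem abs_le_add_mul_pow_four (x : ℝ) {c : ℝ} (hc : 0 < c) : |x| ≤ c + c⁻¹ ^ 3 * x ^ 4 := by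
  rcases le_total |x| c with h | h
  · have : 0 ≤ c⁻¹ ^ 3 * x ^ 4 := by positivity
    linarith
  · have h1 : c ^ 3 ≤ |x| ^ 3 := by gcongr
    have h2 : |x| ≤ c⁻¹ ^ 3 * x ^ 4 := by
      rw [inv_pow, ← div_eq_inv_mul, le_div_iff₀ (by positivity), ← Even.pow_abs (n := 4) (by decide),
        pow_succ' |x| 3]
      exact mul_le_mul_of_nonneg_left h1 (abs_nonneg x)
    linarith

theorem integrable_pow_four_gaussianReal : Integrable (fun x => x ^ 4) (gaussianReal 0 1) := by
  have h := (IsGaussian.memLp_id (gaussianReal 0 1) 4 (by simp)).integrable_norm_pow (by norm_num)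
  refine h.congr (ae_of_all _ fun x => ?_)
  simp only [id_eq, Real.norm_eq_abs]
  exact Even.pow_abs (by decide) x

/-- Nonnegative functions with summable integrals are almost everywhere summable. -/
theorem ae_summable_of_summable_integral {α : Type*} {m : MeasurableSpace α} {μ : Measure α}
    {f : ℕ → α → ℝ} (h0 : ∀ n x, 0 ≤ f n x) (hf : ∀ n, Integrable (f n) μ)
    (hs : Summable fun n => ∫ x, f n x ∂μ) : ∀ᵐ x ∂μ, Summable fun n => f n x := by
  have hlt : ∫⁻ x, ∑' n, ENNReal.ofReal (f n x) ∂μ ≠ ∞ := by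
    rw [lintegral_tsum fun n => (hf n).aemeasurable.ennreal_ofReal]
    simp_rw [← ofReal_integral_eq_lintegral_ofReal (hf _) (ae_of_all _ (h0 _))]
    exact hs.tsum_ofReal_ne_top
  filter_upwards [ae_lt_top' (AEMeasurable.tsum fun n =>
    (hf n).aemeasurable.ennreal_ofReal) hlt] with x hx
  simpa only [ENNReal.toReal_ofReal (h0 _ x)] using ENNReal.summable_toReal hx.ne

theorem ae_summable_pow_four : ∀ᵐ ω ∂gaussianNoise, Summable fun N : ℕ =>
    (48 / 125 : ℝ) ^ N * ∑ k ∈ Finset.range (2 ^ N), ω ⟨N, k⟩ ^ 4 := by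
  have hmp : ∀ p, MeasurePreserving (fun ω : (Σ _ : ℕ, ℕ) → ℝ => ω p) gaussianNoise
    (gaussianReal 0 1) := fun p => measurePreserving_eval_infinitePi _ p
  have hint : ∀ p, Integrable (fun ω : (Σ _ : ℕ, ℕ) → ℝ => ω p ^ 4) gaussianNoise := fun p =>
    (hmp p).integrable_comp_of_integrable integrable_pow_four_gaussianReal
  have hval : ∀ p, ∫ ω, ω p ^ 4 ∂gaussianNoise = ∫ x, x ^ 4 ∂gaussianReal 0 1 := fun p => by
    rw [← (hmp p).map_eq, integral_map (hmp p).aemeasurable (by fun_prop)]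
  refine ae_summable_of_summable_integral (fun N ω => by positivity)
    (fun N => (integrable_finsetSum _ fun k _ => hint ⟨N, k⟩).const_mul _) ?_
  have : ∀ N : ℕ, ∫ ω, (48 / 125 : ℝ) ^ N * ∑ k ∈ Finset.range (2 ^ N), ω ⟨N, k⟩ ^ 4
      ∂gaussianNoise = (96 / 125) ^ N * ∫ x, x ^ 4 ∂gaussianReal 0 1 := fun N => by
    rw [integral_const_mul, integral_finsetSum _ fun k _ => hint ⟨N, k⟩]
    simp_rw [hval]
    rw [Finset.sum_const, Finset.card_range, nsmul_eq_mul, ← mul_assoc, Nat.cast_pow, ← mul_pow]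
    norm_num
  simp_rw [this]
  exact (summable_geometric_of_lt_one (by norm_num) (by norm_num)).mul_right _

/-- The Schauder expansion converges uniformly, almost surely. -/
theorem ae_exists_tendsto_schauderSum :
    ∀ᵐ ω ∂gaussianNoise, ∃ x, Tendsto (fun N => schauderSum N ω) atTop (𝓝 x) := by
  filter_upwards [ae_summable_pow_four] with ω hω
  refine cauchySeq_tendsto_of_complete (cauchySeq_of_dist_le_of_summable (fun N : ℕ =>
    (15 / 16 : ℝ) ^ N + (48 / 125 : ℝ) ^ N * ∑ k ∈ Finset.range (2 ^ N), ω ⟨N, k⟩ ^ 4)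
    (fun N => ?_) ((summable_geometric_of_lt_one (by norm_num) (by norm_num)).add hω))
  have hs : (√2)⁻¹ ≤ (3 / 4 : ℝ) := by
    rw [inv_le_comm₀ (by positivity) (by norm_num)]
    exact Real.le_sqrt_of_sq_le (by norm_num)
  -- With `c = (5 / 4) ^ N` and `(√2)⁻¹ ≤ 3 / 4`, the ratios are `3 / 4 * 5 / 4 = 15 / 16` and `3 /
  -- 4 * (4 / 5) ^ 3 = 48 / 125`. The latter stays below `1` after doubling for the `2 ^ N` terms of
  -- the level.
  refine (dist_schauderSum_succ_le (C := (5 / 4) ^ N + ((5 / 4 : ℝ) ^ N)⁻¹ ^ 3 *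
    ∑ k ∈ Finset.range (2 ^ N), ω ⟨N, k⟩ ^ 4) fun k hk => ?_).trans ?_
  · refine (abs_le_add_mul_pow_four _ (c := (5 / 4) ^ N) (by positivity)).trans ?_
    gcongr
    exact Finset.single_le_sum (f := fun k => ω ⟨N, k⟩ ^ 4) (fun j _ => by positivity)
      (Finset.mem_range.2 hk)
  · calc _ ≤ (3 / 4 : ℝ) ^ N * ((5 / 4) ^ N + ((5 / 4 : ℝ) ^ N)⁻¹ ^ 3 *
          ∑ k ∈ Finset.range (2 ^ N), ω ⟨N, k⟩ ^ 4) := by gcongr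
      _ = _ := by
        rw [mul_add, ← mul_assoc, ← inv_pow, ← pow_mul, mul_comm N 3, pow_mul, ← mul_pow,
          ← mul_pow]
        norm_num

/-- The characteristic function of a linear combination of independent normal variables. -/
theorem integral_exp_sum_gaussianNoise (s : Finset (Σ _ : ℕ, ℕ)) (b : (Σ _ : ℕ, ℕ) → ℝ) :
    ∫ ω, Complex.exp ((∑ p ∈ s, ω p * b p : ℝ) * Complex.I) ∂gaussianNoise =
      Complex.exp ((-(∑ p ∈ s, b p ^ 2) / 2 : ℝ)) := by
  have hmeas : ∀ p, Measurable fun ω : (Σ _ : ℕ, ℕ) → ℝ => ω p * b p := fun p => by fun_prop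
  have hind : iIndepFun (fun p (ω : (Σ _ : ℕ, ℕ) → ℝ) => ω p * b p) gaussianNoise :=
    iIndepFun_infinitePi (X := fun p x => x * b p) fun p => by fun_prop
  have hind' : iIndepFun (s.restrict fun p (ω : (Σ _ : ℕ, ℕ) → ℝ) => ω p * b p) gaussianNoise :=
    hind.precomp (g := fun p : s => (p : Σ _ : ℕ, ℕ)) Subtype.val_injective
  -- The argument `1` suffices, since the coefficients `b` already carry the frequency.
  have h := congrFun (iIndepFun.charFun_map_fun_finsetSum_eq_prod
    (fun p _ => (hmeas p).aemeasurable) hind') (1 : ℝ)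
  rw [charFun_apply_real, integral_map
    (Finset.measurable_fun_sum s fun p _ => hmeas p).aemeasurable (by fun_prop)] at h
  simp only [Complex.ofReal_one, one_mul] at h
  rw [h, Finset.prod_apply]
  have hp : ∀ p, charFun (gaussianNoise.map fun ω => ω p * b p) 1 =
      Complex.exp ((-(b p ^ 2) / 2 : ℝ)) := fun p => by
    have : gaussianNoise.map (fun ω => ω p * b p) =
        (gaussianReal 0 1).map (fun x => x * b p) := by
      rw [← (measurePreserving_eval_infinitePi (fun _ : (Σ _ : ℕ, ℕ) => gaussianReal 0 1) p).map_eq,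
        Measure.map_map (by fun_prop) (by fun_prop)]
      rfl
    rw [this, gaussianReal_map_mul_const, charFun_gaussianReal]
    congr 1
    simp
    ring
  simp_rw [hp]
  rw [← Complex.exp_sum]
  congr 1
  push_cast
  rw [← Finset.sum_div, Finset.sum_neg_distrib]

theorem inner_proj (t : ℕ → unitInterval) (n : ℕ) (x : PathSpace)
    (v : EuclideanSpace ℝ (Fin n)) : inner ℝ (proj t n x) v = ∑ i, v i * x.1 (t i) := by
  rw [PiLp.inner_apply]
  rfl

theorem integral_exp_inner_schauderSum (t : ℕ → unitInterval) (n N : ℕ)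
    (v : EuclideanSpace ℝ (Fin n)) :
    ∫ ω, Complex.exp ((inner ℝ (proj t n (schauderSum N ω)) v : ℝ) * Complex.I) ∂gaussianNoise =
      Complex.exp ((-(∑ i, ∑ j, v i * v j * ∑ m ∈ Finset.range N, ∑ k ∈ Finset.range (2 ^ m),
        (schauder m k).1 (t i) * (schauder m k).1 (t j)) / 2 : ℝ)) := by
  have h1 : ∀ ω, inner ℝ (proj t n (schauderSum N ω)) v =
      ∑ p ∈ levels N, ω p * ∑ i, v i * (schauder p.1 p.2).1 (t i) := fun ω => by
    simp_rw [inner_proj, schauderSum_apply, Finset.mul_sum]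
    rw [Finset.sum_comm]
    exact Finset.sum_congr rfl fun p _ => Finset.sum_congr rfl fun i _ => by ring
  -- The quadratic form of the truncated covariance is the variance of a linear form in the noise.
  have h2 : ∑ i, ∑ j, v i * v j * ∑ m ∈ Finset.range N, ∑ k ∈ Finset.range (2 ^ m),
      (schauder m k).1 (t i) * (schauder m k).1 (t j) =
      ∑ p ∈ levels N, (∑ i, v i * (schauder p.1 p.2).1 (t i)) ^ 2 := by
    have h3 : ∀ i j, ∑ m ∈ Finset.range N, ∑ k ∈ Finset.range (2 ^ m),
        (schauder m k).1 (t i) * (schauder m k).1 (t j) =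
        ∑ p ∈ levels N, (schauder p.1 p.2).1 (t i) * (schauder p.1 p.2).1 (t j) := fun i j => by
      rw [levels, Finset.sum_sigma]
    simp_rw [h3, sq, Finset.sum_mul_sum, Finset.mul_sum]
    rw [Finset.sum_comm (s := levels N)]
    refine Finset.sum_congr rfl fun i _ => ?_
    rw [Finset.sum_comm (s := levels N)]
    exact Finset.sum_congr rfl fun j _ => Finset.sum_congr rfl fun p _ => by ring
  simp_rw [h1]
  rw [integral_exp_sum_gaussianNoise, h2]

/-- The existence of the Wiener measure. -/
theorem exists_wienerMeasure : ∃ W : Measure PathSpace, IsProbabilityMeasure W ∧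
    ∀ (t : ℕ → unitInterval) (n : ℕ), W.map (proj t n) = gaussianLaw t n := by
  obtain ⟨B, hB, hlim⟩ := measurable_limit_of_tendsto_metrizable_ae
    (fun N => (continuous_schauderSum N).measurable.aemeasurable) ae_exists_tendsto_schauderSum
  have hW : IsProbabilityMeasure (gaussianNoise.map B) :=
    Measure.isProbabilityMeasure_map hB.aemeasurable
  refine ⟨gaussianNoise.map B, hW, fun t n => ?_⟩
  have hproj := (continuous_proj t n).measurable
  have : IsProbabilityMeasure ((gaussianNoise.map B).map (proj t n)) :=
    Measure.isProbabilityMeasure_map hproj.aemeasurable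
  have : IsProbabilityMeasure (gaussianLaw t n) := by unfold gaussianLaw; infer_instance
  refine Measure.ext_of_charFun (funext fun v => ?_)
  have hcont : Continuous fun x : PathSpace =>
      Complex.exp ((inner ℝ (proj t n x) v : ℝ) * Complex.I) := by
    have := continuous_proj t n
    fun_prop
  have hleft : Tendsto (fun N => ∫ ω, Complex.exp ((inner ℝ (proj t n (schauderSum N ω)) v : ℝ) *
      Complex.I) ∂gaussianNoise) atTop
      (𝓝 (charFun ((gaussianNoise.map B).map (proj t n)) v)) := by
    rw [charFun_apply, integral_map hproj.aemeasurable (by fun_prop),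
      integral_map hB.aemeasurable hcont.aestronglyMeasurable]
    refine tendsto_integral_of_dominated_convergence (fun _ => 1)
      (fun N => (hcont.comp (continuous_schauderSum N)).aestronglyMeasurable)
      (integrable_const _) (fun N => ae_of_all _ fun ω => ?_) ?_
    · rw [Complex.norm_exp_ofReal_mul_I]
    · filter_upwards [hlim] with ω hω
      exact (hcont.tendsto _).comp hω
  -- The same integrals converge to the Gaussian characteristic function, by the Parseval identity
  -- in the exponent.
  refine tendsto_nhds_unique hleft ?_
  simp_rw [integral_exp_inner_schauderSum]
  rw [gaussianLaw, charFun_multivariateGaussian (posSemidef_covMatrix t n)]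
  have e : (inner ℝ v (0 : EuclideanSpace ℝ (Fin n)) : ℝ) * Complex.I -
      ((v.ofLp ⬝ᵥ (covMatrix t n).mulVec v.ofLp : ℝ) : ℂ) / 2 =
      ((-(∑ i, ∑ j, v i * v j * min (t i : ℝ) (t j)) / 2 : ℝ) : ℂ) := by
    rw [inner_zero_right]
    simp only [dotProduct, Matrix.mulVec, covMatrix, Matrix.of_apply, Finset.mul_sum]
    push_cast
    rw [zero_mul, zero_sub, neg_div]
    congr 2
    exact Finset.sum_congr rfl fun i _ => Finset.sum_congr rfl fun j _ => by ring
  rw [e]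
  exact (Complex.continuous_exp.comp Complex.continuous_ofReal).continuousAt.tendsto.comp
    (((tendsto_finsetSum Finset.univ fun (i : Fin n) _ =>
      tendsto_finsetSum Finset.univ fun (j : Fin n) _ =>
      (tendsto_sum_schauder_mul_schauder (t i) (t j)).const_mul (v i * v j)).neg).div_const 2)

/-! ### The masses of cylinder sets around a compact set -/

variable {t : ℕ → unitInterval} {W : Measure PathSpace} {K : Set PathSpace}

theorem proj_eq_iff {n : ℕ} {x y : PathSpace} :
    proj t n x = proj t n y ↔ ∀ i < n, x.1 (t i) = y.1 (t i) :=
  ⟨fun h i hi => congrFun (congrArg WithLp.ofLp h) ⟨i, hi⟩,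
    fun h => congrArg (WithLp.toLp 2) (funext fun i => h i i.2)⟩

theorem antitone_preimage_proj_image (t : ℕ → unitInterval) (K : Set PathSpace) :
    Antitone fun n => proj t n ⁻¹' (proj t n '' K) := by
  rintro m n hmn x ⟨y, hy, hyx⟩
  exact ⟨y, hy, proj_eq_iff.2 fun i hi => proj_eq_iff.1 hyx i (hi.trans_le hmn)⟩

/-- A compact set is the intersection of the cylinder sets around it. -/
theorem iInter_preimage_proj_image (ht : DenseRange t) (hK : IsCompact K) :
    ⋂ n, proj t n ⁻¹' (proj t n '' K) = K := by
  refine Set.Subset.antisymm (fun x hx => ?_)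
    (Set.subset_iInter fun n => Set.subset_preimage_image _ _)
  -- Each `y n` in `K` agrees with `x` at the first `n` times, so a subsequential limit agrees with
  -- `x` at every time `t i`, hence everywhere.
  choose y hyK hy using Set.mem_iInter.1 hx
  obtain ⟨z, hz, φ, hφ, hlim⟩ := hK.tendsto_subseq hyK
  suffices h : x = z by rwa [h]
  refine Subtype.ext (DFunLike.coe_injective (ht.equalizer x.1.continuous z.1.continuous
    (funext fun i => ?_)))
  have h1 : Tendsto (fun j => (y (φ j)).1 (t i)) atTop (𝓝 (z.1 (t i))) :=
    (((ContinuousEvalConst.continuous_eval_const (t i)).comp continuous_subtype_val).tendsto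
      z).comp hlim
  refine tendsto_nhds_unique (tendsto_const_nhds.congr' ?_) h1
  filter_upwards [eventually_gt_atTop i] with j hj
  exact (proj_eq_iff.1 (hy (φ j)) i (hj.trans_le hφ.le_apply)).symm

/-- The image of `K` is compact, hence Borel, and lies in the range of the projection, so repeated
or zero times need no separate treatment. -/
theorem cylinderMass_eq (hWt : ∀ n, W.map (proj t n) = gaussianLaw t n) (hK : IsCompact K)
    (n : ℕ) : cylinderMass t K n = W (proj t n ⁻¹' (proj t n '' K)) := by
  have hm : MeasurableSet (proj t n '' K) :=
    (hK.image (continuous_proj t n)).isClosed.measurableSet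
  rw [cylinderMass, cylinderMeasure_preimage t n hm,
    Set.inter_eq_left.2 (Set.image_subset_range _ _), ← hWt n,
    Measure.map_apply (continuous_proj t n).measurable hm]

theorem tendsto_cylinderMass [IsFiniteMeasure W] (ht : DenseRange t)
    (hWt : ∀ n, W.map (proj t n) = gaussianLaw t n) (hK : IsCompact K) :
    Tendsto (cylinderMass t K) atTop (𝓝 (W K)) := by
  have h := tendsto_measure_iInter_atTop (μ := W) (s := fun n => proj t n ⁻¹' (proj t n '' K))
    (fun n => ((hK.image (continuous_proj t n)).isClosed.preimage
      (continuous_proj t n)).measurableSet.nullMeasurableSet)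
    (antitone_preimage_proj_image t K) ⟨0, measure_ne_top _ _⟩
  rw [iInter_preimage_proj_image ht hK] at h
  exact h.congr fun n => (cylinderMass_eq hWt hK n).symm

theorem phi_eq [IsFiniteMeasure W] (ht : DenseRange t)
    (hWt : ∀ n, W.map (proj t n) = gaussianLaw t n) (hK : IsCompact K) : phi t K = W K :=
  (tendsto_cylinderMass ht hWt hK).limUnder_eq

theorem mu_eq [IsFiniteMeasure W] (ht : DenseRange t)
    (hWt : ∀ n, W.map (proj t n) = gaussianLaw t n) {A : Set PathSpace} (hA : MeasurableSet A) :
    mu t A = W A := by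
  -- Inner regularity of `W`; the two suprema then differ only in the order of their side
  -- conditions.
  rw [hA.measure_eq_iSup_isCompact_of_ne_top (measure_ne_top W A), mu]
  refine le_antisymm (iSup_le fun K => iSup_le fun hK => iSup_le fun hKA => ?_)
    (iSup_le fun K => iSup_le fun hKA => iSup_le fun hK => ?_)
  · rw [phi_eq ht hWt hK]
    exact le_iSup₂_of_le K hKA (le_iSup_of_le hK le_rfl)
  · rw [← phi_eq ht hWt hK]
    exact le_iSup₂_of_le K hK (le_iSup_of_le hKA le_rfl)

end PathSpace

theorem theorem5 (t : ℕ → unitInterval) (ht : DenseRange t) :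
    -- the limit that defines `φ(K)` exists for every compact `K`
    (∀ K : Set PathSpace, IsCompact K →
      Tendsto (PathSpace.cylinderMass t K) atTop (𝓝 (PathSpace.phi t K))) ∧
    -- `μ` is countably additive on the Borel `σ`-field
    (∀ A : ℕ → Set PathSpace, (∀ n, MeasurableSet (A n)) → Pairwise (Function.onFun Disjoint A) →
      PathSpace.mu t (⋃ n, A n) = ∑' n, PathSpace.mu t (A n)) ∧
    -- `μ` has total mass one
    PathSpace.mu t Set.univ = 1 ∧
    -- `μ` is a probability measure on the Borel `σ`-field
    (∃ P : Measure PathSpace, IsProbabilityMeasure P ∧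
      ∀ A : Set PathSpace, MeasurableSet A → P A = PathSpace.mu t A) := by
  obtain ⟨W, hW, hWmap⟩ := PathSpace.exists_wienerMeasure
  have hWt := hWmap t
  refine ⟨fun K hK => ?_, fun A hA hdisj => ?_, ?_, W, hW, fun A hA => ?_⟩
  · rw [PathSpace.phi_eq ht hWt hK]
    exact PathSpace.tendsto_cylinderMass ht hWt hK
  · rw [PathSpace.mu_eq ht hWt (MeasurableSet.iUnion hA), measure_iUnion hdisj hA]
    exact tsum_congr fun n => (PathSpace.mu_eq ht hWt (hA n)).symm
  · rw [PathSpace.mu_eq ht hWt MeasurableSet.univ, measure_univ]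
  · rw [PathSpace.mu_eq ht hWt hA]
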